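/- Let $A$ and $A'$ be unital $C^*$-algebras, each with an action $\alpha$, resp. $\alpha'$, of $U(1)$ by $*$-automorphisms such that $\lambda\mapsto\alpha_\lambda(a)$ and $\lambda\mapsto\alpha'_\lambda(a')$ are norm-continuous for all $a\in A$, $a'\in A'$. Let $f\colon A\to A'$ be a unital $U(1)$-equivariant $*$-homomorphism, i.e. $f(\alpha_\lambda(a))=\alpha'_\lambda(f(a))$ for all $\lambda\in U(1)$ and $a\in A$. Let $B=A^{U(1)}$ and $B'=(A')^{U(1)}$ be the fixed-point $C^*$-subalgebras, and for $n\in\mathbb{Z}$ let $$A_n=\{a\in A\mid \alpha_\lambda(a)=\lambda^n a\ \text{for all }\lambda\in U(1)\},\qquad A'_n=\{a'\in A'\mid \alpha'_\lambda(a')=\lambda^n a'\ \text{for all }\lambda\in U(1)\}$$ be the spectral subspaces, regarded as left modules over $B$ and $B'$, respectively, by multiplication. Assume that the action on $A$ is $C^*$-free, i.e. that the closed linear span of $\{a\,\delta(b)\mid a,b\in A\}$ is all of $C(U(1),A)$, where $\delta(b)(\lambda)=\alpha_\lambda(b)$ and $a$ is regarded as a constant function. Then for every $n\in\mathbb{Z}$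 there is an isomorphism of finitely generated left $B'$-modules $$B'\otimes_B A_n\;\cong\;A'_n ,$$ where $B'$ is a right $B$-module via $b'\cdot b=b'f(b)$. Moreover, $A_n$ and $A'_n$ are finitely generated projective left modules over $B$ and $B'$, respectively, and the map $(f|_B)_*\colon K_0(B)\to K_0(B')$ induced by the restriction $f|_B\colon B\to B'$ satisfies $$(f|_B)_*([A_n])=[A'_n]\qquad\text{for every } n\in\mathbb{Z}.$$ Here $K_0(R)$ is the Grothendieck group of the monoid (under direct sum) of isomorphism classes of finitely generated projective left $R$-modules, equivalently of equivalence classes of idempotent matrices over $R$ ($E\sim F$ if $E=XY$ and $F=YX$ for some rectangular matrices $X,Y$), where $E\in M_m(R)$ represents the left module $R^mE$, and $(f|_B)_*$ applies $f|_B$ entrywise to idempotent matrices. -/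

import Mathlib

open scoped TensorProduct

/-! ### Extension of scalars over a noncommutative ring -/

/-- `S ⊗_R M` for a ring homomorphism `φ : R → S` and a left `R`-module `M`, where `S` is the
`S`-`R`-bimodule with right action `s · r = s * φ r`. It is the quotient of `S ⊗_ℤ M` by the
relations `(s * φ r) ⊗ m = s ⊗ (r • m)`; the set of relators is stable under left multiplication
by `S`, so its `S`-span is the additive subgroup that it generates. -/
abbrev ExtendScalars {R S : Type*} [Ring R] [Ring S] (φ : R →+* S)
    (M : Type*) [AddCommGroup M] [Module R M] : Type _ :=
  (S ⊗[ℤ] M) ⧸ Submodule.span S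
    {t : S ⊗[ℤ] M | ∃ (s : S) (r : R) (m : M), t = (s * φ r) ⊗ₜ[ℤ] m - s ⊗ₜ[ℤ] (r • m)}

/-! ### The group `K₀` of a ring through idempotent matrices -/

namespace KTheory

section MvN

variable {R : Type*} [Ring R]

/-- Algebraic (Murray-von Neumann) equivalence of two square matrices, of possibly different
sizes: `E = X Y` and `F = Y X` for some rectangular matrices `X` and `Y`. -/
def MvN {ι κ : Type*} [Fintype ι] [Fintype κ] (E : Matrix ι ι R) (F : Matrix κ κ R) : Prop :=
  ∃ (X : Matrix ι κ R) (Y : Matrix κ ι R), E = X * Y ∧ F = Y * X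

theorem MvN.symm {ι κ : Type*} [Fintype ι] [Fintype κ] {E : Matrix ι ι R} {F : Matrix κ κ R}
    (h : MvN E F) : MvN F E := by
  obtain ⟨X, Y, h1, h2⟩ := h
  exact ⟨Y, X, h2, h1⟩

theorem MvN.trans {ι κ μ : Type*} [Fintype ι] [Fintype κ] [Fintype μ] {E : Matrix ι ι R}
    {F : Matrix κ κ R} {G : Matrix μ μ R} (hE : IsIdempotentElem E) (hG : IsIdempotentElem G)
    (h : MvN E F) (h' : MvN F G) : MvN E G := by
  obtain ⟨X, Y, h1, h2⟩ := h
  obtain ⟨Z, W, h3, h4⟩ := h'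
  refine ⟨X * Z, W * Y, ?_, ?_⟩
  · calc E = E * E := hE.symm
      _ = X * (Y * X) * Y := by simp only [h1, Matrix.mul_assoc]
      _ = X * (Z * W) * Y := by rw [← h2, h3]
      _ = _ := by simp only [Matrix.mul_assoc]
  · calc G = G * G := hG.symm
      _ = W * (Z * W) * Z := by simp only [h4, Matrix.mul_assoc]
      _ = W * (Y * X) * Z := by rw [← h3, h2]
      _ = _ := by simp only [Matrix.mul_assoc]

theorem MvN.of_submatrix {ι κ : Type*} [Fintype ι] [Fintype κ] {E : Matrix ι ι R}
    (hE : IsIdempotentElem E) (e : κ ≃ ι) : MvN (E.submatrix e e) E := by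
  refine ⟨E.submatrix e id, E.submatrix id e, ?_, ?_⟩
  · have h := Matrix.submatrix_mul E E e id e Function.bijective_id
    rw [hE.eq] at h
    exact h
  · rw [Matrix.submatrix_mul_equiv, hE.eq, Matrix.submatrix_id_id]

theorem MvN.fromBlocks {ι κ ι' κ' : Type*} [Fintype ι] [Fintype κ] [Fintype ι'] [Fintype κ']
    {E : Matrix ι ι R} {F : Matrix κ κ R} {E' : Matrix ι' ι' R} {F' : Matrix κ' κ' R}
    (h : MvN E F) (h' : MvN E' F') :
    MvN (Matrix.fromBlocks E 0 0 E') (Matrix.fromBlocks F 0 0 F') := by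
  obtain ⟨X, Y, h1, h2⟩ := h
  obtain ⟨X', Y', h3, h4⟩ := h'
  refine ⟨Matrix.fromBlocks X 0 0 X', Matrix.fromBlocks Y 0 0 Y', ?_, ?_⟩ <;>
    simp [Matrix.fromBlocks_multiply, h1, h2, h3, h4]

theorem isIdempotentElem_fromBlocks {ι κ : Type*} [Fintype ι] [Fintype κ] {E : Matrix ι ι R}
    {F : Matrix κ κ R} (hE : IsIdempotentElem E) (hF : IsIdempotentElem F) :
    IsIdempotentElem (Matrix.fromBlocks E 0 0 F) := by
  unfold IsIdempotentElem
  simp [Matrix.fromBlocks_multiply, hE.eq, hF.eq]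

theorem isIdempotentElem_submatrix {ι κ : Type*} [Fintype ι] [Fintype κ] {E : Matrix ι ι R}
    (hE : IsIdempotentElem E) (e : κ ≃ ι) : IsIdempotentElem (E.submatrix e e) := by
  unfold IsIdempotentElem
  rw [Matrix.submatrix_mul_equiv, hE.eq]

end MvN

/-- Idempotent matrices over `R` of arbitrary finite size. -/
structure Idem (R : Type*) [Ring R] where
  size : ℕ
  mat : Matrix (Fin size) (Fin size) R
  idem : IsIdempotentElem mat

namespace Idem

variable {R : Type*} [Ring R]

instance setoid (R : Type*) [Ring R] : Setoid (Idem R) where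
  r E F := MvN E.mat F.mat
  iseqv :=
    { refl := fun E => ⟨E.mat, E.mat, E.idem.symm, E.idem.symm⟩
      symm := MvN.symm
      trans := fun {E _ G} => MvN.trans E.idem G.idem }

/-- The direct sum, that is the block-diagonal matrix. -/
def add (E F : Idem R) : Idem R where
  size := E.size + F.size
  mat := (Matrix.fromBlocks E.mat 0 0 F.mat).submatrix finSumFinEquiv.symm finSumFinEquiv.symm
  idem := isIdempotentElem_submatrix (isIdempotentElem_fromBlocks E.idem F.idem) _

/-- The idempotent of size zero. -/
def zero (R : Type*) [Ring R] : Idem R where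
  size := 0
  mat := 0
  idem := by simp [IsIdempotentElem]

/-- The entrywise image under a ring homomorphism. -/
def map {S : Type*} [Ring S] (φ : R →+* S) (E : Idem R) : Idem S where
  size := E.size
  mat := E.mat.map φ
  idem := by
    unfold IsIdempotentElem
    rw [← Matrix.map_mul, E.idem.eq]

theorem add_mvN (E F : Idem R) : MvN (E.add F).mat (Matrix.fromBlocks E.mat 0 0 F.mat) :=
  MvN.of_submatrix (isIdempotentElem_fromBlocks E.idem F.idem) _

theorem add_congr {E E' F F' : Idem R} (h : E ≈ E') (h' : F ≈ F') : E.add F ≈ E'.add F' :=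
  MvN.trans (add E F).idem (add E' F').idem (add_mvN E F)
    (MvN.trans (isIdempotentElem_fromBlocks E.idem F.idem) (add E' F').idem
      (MvN.fromBlocks h h') (add_mvN E' F').symm)

theorem add_comm' (E F : Idem R) : E.add F ≈ F.add E := by
  refine MvN.trans (add E F).idem (add F E).idem (add_mvN E F)
    (MvN.trans (isIdempotentElem_fromBlocks E.idem F.idem) (add F E).idem ?_ (add_mvN F E).symm)
  have h := MvN.of_submatrix (isIdempotentElem_fromBlocks F.idem E.idem)
    (Equiv.sumComm (Fin E.size) (Fin F.size))
  simpa using h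

theorem zero_add' (E : Idem R) : (zero R).add E ≈ E := by
  refine MvN.trans (add (zero R) E).idem E.idem (add_mvN (zero R) E) ?_
  have : IsEmpty (Fin (zero R).size) := inferInstanceAs (IsEmpty (Fin 0))
  refine ⟨Matrix.of (Sum.elim (fun i => isEmptyElim i) E.mat),
    Matrix.of (fun i => Sum.elim (fun j => isEmptyElim j) (E.mat i)), ?_, ?_⟩
  · ext i j
    rcases i with i | i
    · exact isEmptyElim i
    rcases j with j | j
    · exact isEmptyElim j
    exact (congrFun (congrFun E.idem.eq i) j).symm
  · ext i j
    have h := (congrFun (congrFun E.idem.eq i) j).symm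
    rw [Matrix.mul_apply] at h ⊢
    rw [Fintype.sum_sum_type, Fintype.sum_empty, _root_.zero_add]
    exact h

theorem add_assoc' (E F G : Idem R) : (E.add F).add G ≈ E.add (F.add G) := by
  have hEF := isIdempotentElem_fromBlocks E.idem F.idem
  have hFG := isIdempotentElem_fromBlocks F.idem G.idem
  have h1 : MvN ((E.add F).add G).mat
      (Matrix.fromBlocks (Matrix.fromBlocks E.mat 0 0 F.mat) 0 0 G.mat) :=
    MvN.trans ((E.add F).add G).idem (isIdempotentElem_fromBlocks hEF G.idem)
      (add_mvN (E.add F) G)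
      (MvN.fromBlocks (add_mvN E F) ⟨G.mat, G.mat, G.idem.symm, G.idem.symm⟩)
  have h2 : MvN (E.add (F.add G)).mat
      (Matrix.fromBlocks E.mat 0 0 (Matrix.fromBlocks F.mat 0 0 G.mat)) :=
    MvN.trans (E.add (F.add G)).idem (isIdempotentElem_fromBlocks E.idem hFG)
      (add_mvN E (F.add G))
      (MvN.fromBlocks ⟨E.mat, E.mat, E.idem.symm, E.idem.symm⟩ (add_mvN F G))
  refine MvN.trans ((E.add F).add G).idem (E.add (F.add G)).idem h1
    (MvN.trans (isIdempotentElem_fromBlocks hEF G.idem) (E.add (F.add G)).idem ?_ h2.symm)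
  have h := MvN.of_submatrix (isIdempotentElem_fromBlocks E.idem hFG)
    (Equiv.sumAssoc (Fin E.size) (Fin F.size) (Fin G.size))
  convert h using 1
  ext i j
  rcases i with (i | i) | i <;> rcases j with (j | j) | j <;> simp

theorem map_congr {S : Type*} [Ring S] (φ : R →+* S) {E F : Idem R} (h : E ≈ F) :
    E.map φ ≈ F.map φ := by
  obtain ⟨X, Y, h1, h2⟩ := h
  refine ⟨X.map φ, Y.map φ, ?_, ?_⟩
  · exact (congrArg (fun N => N.map φ) h1).trans Matrix.map_mul
  · exact (congrArg (fun N => N.map φ) h2).trans Matrix.map_mul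

theorem map_add {S : Type*} [Ring S] (φ : R →+* S) (E F : Idem R) :
    (E.add F).map φ = (E.map φ).add (F.map φ) := by
  have h : (E.add F).mat.map φ = ((E.map φ).add (F.map φ)).mat := by
    simp [add, map, ← Matrix.submatrix_map, Matrix.fromBlocks_map, Matrix.map_zero]
  unfold map add at *
  congr 1

end Idem

/-- The monoid of equivalence classes of idempotent matrices over `R`. -/
def V (R : Type*) [Ring R] : Type _ := Quotient (Idem.setoid R)

namespace V

variable {R : Type*} [Ring R]

/-- The class of an idempotent matrix. -/
def mk (E : Idem R) : V R := Quotient.mk (Idem.setoid R) E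

instance : Zero (V R) := ⟨mk (Idem.zero R)⟩

instance : Add (V R) :=
  ⟨Quotient.map₂ Idem.add (fun _ _ h _ _ h' => Idem.add_congr h h')⟩

instance : AddCommMonoid (V R) where
  add_assoc := by
    rintro ⟨E⟩ ⟨F⟩ ⟨G⟩
    exact Quotient.sound (Idem.add_assoc' E F G)
  add_comm := by
    rintro ⟨E⟩ ⟨F⟩
    exact Quotient.sound (Idem.add_comm' E F)
  zero_add := by
    rintro ⟨E⟩
    exact Quotient.sound (Idem.zero_add' E)
  add_zero := by
    rintro ⟨E⟩
    exact Quotient.sound (Setoid.trans (Idem.add_comm' E (Idem.zero R)) (Idem.zero_add' E))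
  nsmul := nsmulRec

/-- The homomorphism induced by a ring homomorphism, applied entrywise to idempotents. -/
def map {S : Type*} [Ring S] (φ : R →+* S) : V R →+ V S where
  toFun := Quotient.map (Idem.map φ) (fun _ _ h => Idem.map_congr φ h)
  map_zero' := by
    have h : (Idem.zero R).map φ = Idem.zero S := by
      have h0 : (Idem.zero R).mat.map φ = (Idem.zero S).mat := by
        ext i; exact i.elim0
      unfold Idem.map Idem.zero at *
      congr 1
    exact congrArg mk h
  map_add' := by
    rintro ⟨E⟩ ⟨F⟩
    exact congrArg mk (Idem.map_add φ E F)

end V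

/-- `K₀(R)`, the Grothendieck group of the monoid of classes of idempotent matrices. -/
abbrev K0 (R : Type*) [Ring R] : Type _ := Algebra.GrothendieckAddGroup (V R)

namespace K0

variable {R : Type*} [Ring R]

/-- The class in `K₀(R)` of an idempotent matrix. -/
noncomputable def mk (E : Idem R) : K0 R := Algebra.GrothendieckAddGroup.of (V.mk E)

/-- The induced homomorphism `φ_* : K₀(R) → K₀(S)`. -/
noncomputable def map {S : Type*} [Ring S] (φ : R →+* S) : K0 R →+ K0 S :=
  Algebra.GrothendieckAddGroup.lift (Algebra.GrothendieckAddGroup.of.comp (V.map φ))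

/-- The idempotent `E ∈ Mₙ(R)` represents the left `R`-module `M` if `M ≅ Rⁿ E`, where `Rⁿ`
consists of row vectors. -/
def Represents (E : Idem R) (M : Type*) [AddCommGroup M] [Module R M] : Prop :=
  Nonempty (M ≃ₗ[R] LinearMap.range (Matrix.vecMulLinear E.mat))

theorem exists_represents (M : Type*) [AddCommGroup M] [Module R M]
    [Module.Finite R M] [Module.Projective R M] : ∃ E : Idem R, Represents E M := by
  obtain ⟨n, f, g, hf, hg, hfg⟩ := Module.Finite.exists_comp_eq_id_of_projective R M
  have hfg' : ∀ x, f (g x) = x := fun x => LinearMap.congr_fun hfg x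
  let E : Matrix (Fin n) (Fin n) R := Matrix.of fun i j => g (f (Pi.single i 1)) j
  have hE : Matrix.vecMulLinear E = g ∘ₗ f := by
    refine LinearMap.pi_ext' fun i => LinearMap.ext_ring ?_
    ext j
    simp [E]
  have hidem : IsIdempotentElem E := by
    have h : ∀ v : Fin n → R, Matrix.vecMul v (E * E) = Matrix.vecMul v E := by
      intro v
      rw [← Matrix.vecMul_vecMul]
      change Matrix.vecMulLinear E (Matrix.vecMulLinear E v) = Matrix.vecMulLinear E v
      simp [hE, hfg']
    ext i j
    have := congrFun (h (Pi.single i 1)) j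
    simpa using this
  refine ⟨⟨n, E, hidem⟩, ⟨?_⟩⟩
  have hr : LinearMap.range (Matrix.vecMulLinear E) = LinearMap.range g := by
    rw [hE, LinearMap.range_comp, LinearMap.range_eq_top.2 hf, Submodule.map_top]
  exact (LinearEquiv.ofInjective g hg).trans (LinearEquiv.ofEq _ _ hr.symm)

theorem represents_unique {M : Type*} [AddCommGroup M] [Module R M] {E F : Idem R}
    (hE : Represents E M) (hF : Represents F M) : E ≈ F := by
  obtain ⟨a⟩ := hE
  obtain ⟨b⟩ := hF
  -- an isomorphism of the two row spaces gives the first of the two matrices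
  have key : ∀ {E F : Idem R} (t : LinearMap.range (Matrix.vecMulLinear E.mat) ≃ₗ[R]
      LinearMap.range (Matrix.vecMulLinear F.mat)), ∃ X : Matrix (Fin E.size) (Fin F.size) R,
      ∀ v, Matrix.vecMul v X = (t ((Matrix.vecMulLinear E.mat).rangeRestrict v)).1 := by
    intro E F t
    let L : (Fin E.size → R) →ₗ[R] (Fin F.size → R) :=
      (Submodule.subtype _) ∘ₗ t.toLinearMap ∘ₗ (Matrix.vecMulLinear E.mat).rangeRestrict
    refine ⟨Matrix.of fun i j => L (Pi.single i 1) j, fun v => ?_⟩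
    have hL : Matrix.vecMulLinear (Matrix.of fun i j => L (Pi.single i 1) j) = L := by
      refine LinearMap.pi_ext' fun i => LinearMap.ext_ring ?_
      ext j
      simp
    exact LinearMap.congr_fun hL v
  have fix : ∀ (E : Idem R) (x : LinearMap.range (Matrix.vecMulLinear E.mat)),
      (Matrix.vecMulLinear E.mat).rangeRestrict x.1 = x := by
    rintro E ⟨_, v, rfl⟩
    apply Subtype.ext
    change Matrix.vecMul (Matrix.vecMul v E.mat) E.mat = Matrix.vecMul v E.mat
    rw [Matrix.vecMul_vecMul, E.idem.eq]
  have ext' : ∀ {n m : ℕ} {P Q : Matrix (Fin n) (Fin m) R},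
      (∀ v, Matrix.vecMul v P = Matrix.vecMul v Q) → P = Q := by
    intro n m P Q h
    ext i j
    have := congrFun (h (Pi.single i 1)) j
    simpa using this
  obtain ⟨X, hX⟩ := key (E := E) (F := F) (a.symm.trans b)
  obtain ⟨Y, hY⟩ := key (E := F) (F := E) (b.symm.trans a)
  refine ⟨X, Y, ext' fun v => ?_, ext' fun v => ?_⟩
  · rw [← Matrix.vecMul_vecMul, hX, hY, fix]
    simp
  · rw [← Matrix.vecMul_vecMul, hY, hX, fix]
    simp

/-- The class `[M] ∈ K₀(R)` of a finitely generated projective left `R`-module `M`: the class of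
any idempotent matrix that represents `M`. -/
noncomputable def ofModule (M : Type*) [AddCommGroup M] [Module R M]
    (_ : Module.Finite R M) (_ : Module.Projective R M) : K0 R :=
  mk (exists_represents (R := R) M).choose

theorem ofModule_eq_mk {M : Type*} [AddCommGroup M] [Module R M]
    (h : Module.Finite R M) (h' : Module.Projective R M) {E : Idem R} (hE : Represents E M) :
    ofModule M h h' = mk E :=
  congrArg Algebra.GrothendieckAddGroup.of
    (Quotient.sound (represents_unique (exists_represents (R := R) M).choose_spec hE))

end K0

end KTheory

/-! ### Circle actions on unital C*-algebras -/

/-- A (point-norm continuous) action of `U(1)` by *-automorphisms on a unital C*-algebra. -/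
structure CircleAction (A : Type*) [CStarAlgebra A] where
  act : Circle →* (A ≃⋆ₐ[ℂ] A)
  continuous_act : ∀ a : A, Continuous fun z : Circle => act z a

namespace CircleAction

variable {A : Type*} [CStarAlgebra A] (α : CircleAction A)

/-- `δ : A → C(U(1), A)`, `δ(a)(z) = α_z(a)`. -/
noncomputable def coaction (a : A) : C(Circle, A) := ⟨fun z => α.act z a, α.continuous_act a⟩

/-- C*-freeness: the closed linear span of `{a δ(b)}` is all of `C(U(1), A)`, in which `a ∈ A`
is read as a constant function. -/
def IsCStarFree : Prop :=
  (Submodule.span ℂ {g : C(Circle, A) | ∃ a b : A,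
    g = ContinuousMap.const Circle a * α.coaction b}).topologicalClosure = ⊤

/-- The fixed-point C*-subalgebra. -/
noncomputable def fixedPoints : StarSubalgebra ℂ A where
  carrier := {a | ∀ z, α.act z a = a}
  mul_mem' := fun {a b} ha hb z => by rw [map_mul, ha z, hb z]
  add_mem' := fun {a b} ha hb z => by rw [map_add, ha z, hb z]
  algebraMap_mem' := fun c z => by
    rw [Algebra.algebraMap_eq_smul_one, map_smul, map_one]
  star_mem' := fun {a} ha z => by rw [map_star, ha z]

/-- The spectral subspace `A_n`, as a left module over the fixed-point algebra. -/
noncomputable def spectralSubspace (n : ℤ) : Submodule α.fixedPoints A where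
  carrier := {a | ∀ z : Circle, α.act z a = ((z : ℂ) ^ n) • a}
  add_mem' := fun {a b} ha hb z => by rw [map_add, ha z, hb z, smul_add]
  zero_mem' := fun z => by rw [map_zero, smul_zero]
  smul_mem' := fun b a ha z => by
    change α.act z ((b : A) * a) = ((z : ℂ) ^ n) • ((b : A) * a)
    rw [map_mul, b.2 z, ha z, mul_smul_comm]

/-- Equivariance of a *-homomorphism. -/
def IsEquivariant {A' : Type*} [CStarAlgebra A'] (α : CircleAction A) (α' : CircleAction A')
    (f : A →⋆ₐ[ℂ] A') : Prop :=
  ∀ (z : Circle) (a : A), f (α.act z a) = α'.act z (f a)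

/-- The homomorphism `f|_B : B → B'` of fixed-point algebras that an equivariant *-homomorphism
`f : A → A'` restricts to. -/
noncomputable def restrictFixed {A' : Type*} [CStarAlgebra A'] {α : CircleAction A} {α' : CircleAction A'}
    {f : A →⋆ₐ[ℂ] A'} (hf : IsEquivariant α α' f) : α.fixedPoints →⋆ₐ[ℂ] α'.fixedPoints :=
  StarAlgHom.codRestrict (f.comp α.fixedPoints.subtype) α'.fixedPoints
    (fun b z => by
      change α'.act z (f b) = f b
      rw [← hf z, b.2 z])

end CircleAction

/-! Freeness is needed only to produce, for each `n`, finitely many `a i ∈ A_{-n}` and `b i ∈ A_n`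
with `∑ a i * b i = 1` (`nonempty_frame`). For this, approximate the function `z ↦ z^n • 1` by a sum
of terms `a δ(b)`. Taking `n`-th Fourier coefficients and then averaging over the action turns each
term into `p_{-n}(a) p_n(b)`, and turns `z^n • 1` into `1`. The result is a fixed element `u` of the
span of `A_{-n} A_n` with `‖1 - u‖ < 1`, so `u` is invertible, and its inverse is absorbed into the
`a i`.

Everything else is algebra. From `x = ∑ (x * a i) * b i`, the module `A_n` is a direct summand of a
free `B`-module, represented by the idempotent `(b i * a j)`. The images `f (a i)`, `f (b i)`
satisfy the same relation in `A'`, so `A'_n` is represented by the entrywise image of that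
idempotent, which is the `K₀` identity. The same data invert the map `b' ⊗ x ↦ b' * f x`. -/

open MeasureTheory

namespace CircleAction

/-! ### Haar measure and vector-valued Fourier coefficients -/

noncomputable instance : MeasurableSpace Circle := borel Circle

instance : BorelSpace Circle := ⟨rfl⟩

/-- The normalised Haar measure on the circle group. -/
noncomputable def haarCircle : Measure Circle :=
  Measure.haarMeasure (⊤ : TopologicalSpace.PositiveCompacts Circle)

instance : IsProbabilityMeasure haarCircle :=
  ⟨Measure.haarMeasure_self (K₀ := (⊤ : TopologicalSpace.PositiveCompacts Circle))⟩

instance : haarCircle.IsMulLeftInvariant := by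
  unfold haarCircle; infer_instance

section Fourier

variable {A : Type*} [CStarAlgebra A]

theorem continuous_zpow_coe (n : ℤ) : Continuous fun z : Circle => (z : ℂ) ^ n :=
  (continuous_subtype_val : Continuous fun z : Circle => (z : ℂ)).zpow₀ n
    fun z => Or.inl (Circle.coe_ne_zero z)

theorem integrable_of_continuous {F : Circle → A} (hF : Continuous F) :
    Integrable F haarCircle :=
  hF.integrable_of_hasCompactSupport (HasCompactSupport.of_compactSpace F)

theorem integrable_zpow_smul (n : ℤ) (F : C(Circle, A)) :
    Integrable (fun z : Circle => (z : ℂ) ^ n • F z) haarCircle :=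
  integrable_of_continuous ((continuous_zpow_coe n).smul F.continuous)

/-- The `n`-th Fourier coefficient of an `A`-valued continuous function on the circle. -/
noncomputable def fourierCoeffₗ (n : ℤ) : C(Circle, A) →ₗ[ℂ] A where
  toFun F := ∫ z : Circle, (z : ℂ) ^ (-n) • F z ∂haarCircle
  map_add' F G := by
    simp only [ContinuousMap.add_apply, smul_add]
    exact integral_add (integrable_zpow_smul _ F) (integrable_zpow_smul _ G)
  map_smul' c F := by
    simp only [ContinuousMap.smul_apply, smul_comm _ c, RingHom.id_apply]
    exact integral_smul c _

theorem fourierCoeffₗ_apply (n : ℤ) (F : C(Circle, A)) :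
    fourierCoeffₗ n F = ∫ z : Circle, (z : ℂ) ^ (-n) • F z ∂haarCircle := rfl

theorem norm_fourierCoeffₗ_le (n : ℤ) (F : C(Circle, A)) : ‖fourierCoeffₗ n F‖ ≤ ‖F‖ := by
  have h := norm_integral_le_of_norm_le_const (μ := haarCircle)
    (f := fun z : Circle => (z : ℂ) ^ (-n) • F z) (C := ‖F‖)
    (Filter.Eventually.of_forall fun z => by
      rw [norm_smul, norm_zpow, z.norm_coe, one_zpow, one_mul]
      exact F.norm_coe_le_norm z)
  simpa [fourierCoeffₗ_apply] using h

theorem fourierCoeffₗ_zpow_smul_one (n : ℤ) :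
    fourierCoeffₗ n (⟨fun z : Circle => (z : ℂ) ^ n • (1 : A),
      (continuous_zpow_coe n).smul continuous_const⟩ : C(Circle, A)) = 1 := by
  have h : ∀ z : Circle, (z : ℂ) ^ (-n) • (z : ℂ) ^ n • (1 : A) = 1 := fun z => by
    rw [smul_smul, ← zpow_add₀ z.coe_ne_zero, neg_add_cancel, zpow_zero, one_smul]
  rw [fourierCoeffₗ_apply]
  exact (integral_congr_ae (Filter.Eventually.of_forall h)).trans (by simp)

end Fourier

/-! ### Projections onto the spectral subspaces -/

variable {A : Type*} [CStarAlgebra A] (α : CircleAction A)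

theorem norm_act (z : Circle) (a : A) : ‖α.act z a‖ = ‖a‖ :=
  NonUnitalStarAlgHom.norm_map (α.act z) (α.act z).injective a

theorem norm_coaction_le (a : A) : ‖α.coaction a‖ ≤ ‖a‖ :=
  (ContinuousMap.norm_le _ (norm_nonneg a)).2 fun z => (α.norm_act z a).le

/-- The coaction as a linear map. -/
noncomputable def coactionₗ : A →ₗ[ℂ] C(Circle, A) where
  toFun := α.coaction
  map_add' a b := by ext z; exact map_add (α.act z) a b
  map_smul' c a := by ext z; exact map_smul (α.act z) c a

/-- The projection of `A` onto its `n`-th spectral subspace. -/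
noncomputable def spectralProj (n : ℤ) : A →ₗ[ℂ] A := fourierCoeffₗ n ∘ₗ α.coactionₗ

theorem spectralProj_apply (n : ℤ) (a : A) :
    α.spectralProj n a = ∫ z : Circle, (z : ℂ) ^ (-n) • α.act z a ∂haarCircle := rfl

theorem norm_spectralProj_le (n : ℤ) (a : A) : ‖α.spectralProj n a‖ ≤ ‖a‖ :=
  (norm_fourierCoeffₗ_le n _).trans (α.norm_coaction_le a)

theorem act_mul_apply (w z : Circle) (a : A) : α.act (w * z) a = α.act w (α.act z a) := by
  rw [map_mul]; rfl

theorem spectralProj_mem (n : ℤ) (a : A) : α.spectralProj n a ∈ α.spectralSubspace n := by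
  intro w
  let L : A →ₗᵢ[ℂ] A := ⟨(α.act w : A →ₗ[ℂ] A), α.norm_act w⟩
  have hL : ∀ x, L x = α.act w x := fun _ => rfl
  have hint := integrable_zpow_smul (-n) (α.coaction a)
  -- The isometry `α_w` passes under the integral; substituting `w⁻¹ * z` for `z` then brings out
  -- the factor `w^n`.
  rw [spectralProj_apply, ← hL, ← L.integral_comp_comm,
    ← integral_mul_left_eq_self _ w⁻¹, ← integral_smul]
  congr 1
  ext z
  rw [hL, map_smul, ← act_mul_apply, mul_inv_cancel_left, smul_smul]
  congr 1
  rw [Circle.coe_mul, Circle.coe_inv, mul_zpow, inv_zpow', neg_neg]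

theorem fourierCoeffₗ_const_mul_coaction (n : ℤ) (a b : A) :
    fourierCoeffₗ n (ContinuousMap.const Circle a * α.coaction b) = a * α.spectralProj n b := by
  refine Eq.trans ?_
    (integral_const_mul_of_integrable (integrable_zpow_smul (-n) (α.coaction b)))
  exact congrArg (integral haarCircle) (funext fun z => (mul_smul_comm _ _ _).symm)

/-- Since `α_z(a x) = z^n α_z(a) x`, averaging selects the part of `a` of degree `-n`. -/
theorem spectralProj_zero_mul (n : ℤ) (a : A) {x : A} (hx : x ∈ α.spectralSubspace n) :
    α.spectralProj 0 (a * x) = α.spectralProj (-n) a * x := by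
  refine Eq.trans ?_
    (integral_mul_const_of_integrable (integrable_zpow_smul (- -n) (α.coaction a)))
  rw [spectralProj_apply]
  refine congrArg (integral haarCircle) (funext fun z => ?_)
  have h : (α.coaction a) z = α.act z a := rfl
  rw [map_mul, hx z, h, neg_neg, mul_smul_comm, smul_mul_assoc, neg_zero, zpow_zero, one_smul]

/-! ### Frames from C*-freeness -/

theorem mul_mem_fixedPoints {n : ℤ} {x a : A} (hx : x ∈ α.spectralSubspace n)
    (ha : a ∈ α.spectralSubspace (-n)) : x * a ∈ α.fixedPoints := by
  intro z
  rw [map_mul, hx z, ha z, smul_mul_smul_comm, ← zpow_add₀ z.coe_ne_zero, add_neg_cancel,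
    zpow_zero, one_smul]

/-- Finitely many elements `a i` of degree `-n` and `b i` of degree `n` with `∑ a i * b i = 1`. -/
structure Frame (n : ℤ) where
  size : ℕ
  a : Fin size → A
  b : Fin size → A
  a_mem : ∀ i, a i ∈ α.spectralSubspace (-n)
  b_mem : ∀ i, b i ∈ α.spectralSubspace n
  sum_eq_one : ∑ i, a i * b i = 1

theorem smul_mem_spectralSubspace {n : ℤ} (c : ℂ) {a : A} (ha : a ∈ α.spectralSubspace n) :
    c • a ∈ α.spectralSubspace n := fun z => by rw [map_smul, ha z, smul_comm]

theorem nonempty_frame (hfree : α.IsCStarFree) (n : ℤ) : Nonempty (α.Frame n) := by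
  let S : Set A := {u | ∃ a ∈ α.spectralSubspace (-n), ∃ b ∈ α.spectralSubspace n, u = a * b}
  let g : C(Circle, A) := ⟨fun z : Circle => (z : ℂ) ^ n • (1 : A),
    (continuous_zpow_coe n).smul continuous_const⟩
  have hg : fourierCoeffₗ n g = 1 := fourierCoeffₗ_zpow_smul_one n
  have hgmem : g ∈ (Submodule.span ℂ {g : C(Circle, A) | ∃ a b : A,
      g = ContinuousMap.const Circle a * α.coaction b}).topologicalClosure := by
    rw [show _ = ⊤ from hfree]; trivial
  -- Distance below `1` suffices: the Fourier coefficient and the average are both contractive, and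
  -- together they send `g` to `1`.
  obtain ⟨s, hs, hgs⟩ := Metric.mem_closure_iff.1 hgmem 1 one_pos
  set u : A := α.spectralProj 0 (fourierCoeffₗ n s) with hu
  have hone : α.spectralProj 0 (1 : A) = 1 := by simp [spectralProj_apply]
  have hnorm : ‖1 - u‖ < 1 := by
    have h : 1 - u = α.spectralProj 0 (fourierCoeffₗ n (g - s)) := by
      rw [map_sub, hg, map_sub, hone]
    rw [h]
    exact ((α.norm_spectralProj_le _ _).trans (norm_fourierCoeffₗ_le _ _)).trans_lt
      (by rwa [← dist_eq_norm])
  have huS : u ∈ Submodule.span ℂ S := by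
    have h : Submodule.span ℂ {g : C(Circle, A) | ∃ a b : A,
        g = ContinuousMap.const Circle a * α.coaction b} ≤
        (Submodule.span ℂ S).comap (α.spectralProj 0 ∘ₗ fourierCoeffₗ n) := by
      rw [Submodule.span_le]
      rintro _ ⟨a, b, rfl⟩
      refine Submodule.subset_span ⟨_, α.spectralProj_mem (-n) a, _, α.spectralProj_mem n b, ?_⟩
      rw [LinearMap.comp_apply, fourierCoeffₗ_const_mul_coaction,
        α.spectralProj_zero_mul n a (α.spectralProj_mem n b)]
    exact h hs
  obtain ⟨N, c, t, htu⟩ := Submodule.mem_span_set'.1 huS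
  choose a ha b hb hab using fun i => (t i).2
  have hunit : IsUnit u := by simpa using isUnit_one_sub_of_norm_lt_one hnorm
  obtain ⟨v, hv⟩ := hunit.exists_left_inv
  have hufix : ∀ z, α.act z u = u := fun z => by
    simpa using α.spectralProj_mem 0 (fourierCoeffₗ n s) z
  -- Both `α_z(v)` and `v` are left inverses of the fixed unit `u`.
  have hvfix : ∀ z, α.act z v = v := fun z => by
    refine hunit.mul_right_cancel ?_
    rw [hv]
    conv_lhs => rw [← hufix z]
    rw [← map_mul, hv, map_one]
  -- As `v` has degree `0`, multiplying by it on the left keeps the degree `-n`.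
  refine ⟨⟨N, fun i => v * (c i • a i), b, fun i => ?_, hb, ?_⟩⟩
  · exact (α.spectralSubspace (-n)).smul_mem ⟨v, hvfix⟩
      (α.smul_mem_spectralSubspace (c i) (ha i))
  · rw [← hv, ← htu, Finset.mul_sum]
    refine Finset.sum_congr rfl fun i _ => ?_
    rw [hab, mul_assoc, smul_mul_assoc]

/-! ### Finite generation, projectivity and the representing idempotent -/

namespace Frame

variable {A : Type*} [CStarAlgebra A] {α : CircleAction A} {n : ℤ} (F : α.Frame n)

/-- The elements `b i` as elements of the spectral subspace. -/
def gen (i : Fin F.size) : α.spectralSubspace n := ⟨F.b i, F.b_mem i⟩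

/-- The coordinate functionals `x ↦ x * a i`, dual to the generators `b i`. -/
noncomputable def coord (i : Fin F.size) : α.spectralSubspace n →ₗ[α.fixedPoints] α.fixedPoints where
  toFun x := ⟨x.1 * F.a i, α.mul_mem_fixedPoints x.2 (F.a_mem i)⟩
  map_add' x y := Subtype.ext (add_mul x.1 y.1 (F.a i))
  map_smul' c x := Subtype.ext (mul_assoc c.1 x.1 (F.a i))

@[simp]
theorem coe_coord (i : Fin F.size) (x : α.spectralSubspace n) :
    (F.coord i x : A) = x.1 * F.a i := rfl

theorem sum_coord_smul (x : α.spectralSubspace n) : ∑ i, F.coord i x • F.gen i = x := by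
  apply Subtype.ext
  rw [Submodule.coe_sum]
  calc ∑ i, x.1 * F.a i * F.b i = x.1 * ∑ i, F.a i * F.b i := by
        rw [Finset.mul_sum]; exact Finset.sum_congr rfl fun i _ => mul_assoc _ _ _
    _ = x.1 := by rw [F.sum_eq_one, mul_one]

/-- The idempotent matrix `(b i * a j)`. -/
noncomputable def idem : KTheory.Idem α.fixedPoints where
  size := F.size
  mat := Matrix.of fun i j => F.coord j (F.gen i)
  idem := by
    ext i k
    -- Idempotency is the expansion of `b i` in the generators, multiplied on the right by `a k`.
    have h := congrArg (F.coord k) (F.sum_coord_smul (F.gen i))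
    simp only [map_sum, map_smul, smul_eq_mul] at h
    simpa [Matrix.mul_apply] using congrArg Subtype.val h

/-- The embedding of the spectral subspace into a free module. -/
noncomputable def embed : α.spectralSubspace n →ₗ[α.fixedPoints] (Fin F.size → α.fixedPoints) :=
  LinearMap.pi F.coord

/-- The projection of the free module onto the spectral subspace. -/
noncomputable def proj : (Fin F.size → α.fixedPoints) →ₗ[α.fixedPoints] α.spectralSubspace n :=
  Fintype.linearCombination α.fixedPoints F.gen

theorem proj_embed (x : α.spectralSubspace n) : F.proj (F.embed x) = x := by
  rw [proj, Fintype.linearCombination_apply]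
  exact F.sum_coord_smul x

theorem embed_proj (v : Fin F.size → α.fixedPoints) :
    F.embed (F.proj v) = Matrix.vecMulLinear F.idem.mat v := by
  ext j
  change ((F.coord j (F.proj v) : α.fixedPoints) : A) =
    (Matrix.vecMul v F.idem.mat j : α.fixedPoints)
  rw [proj, Fintype.linearCombination_apply, map_sum]
  simp only [map_smul]
  rfl

include F in
theorem finite : Module.Finite α.fixedPoints (α.spectralSubspace n) :=
  Module.Finite.of_surjective F.proj fun x => ⟨_, F.proj_embed x⟩

include F in
theorem projective : Module.Projective α.fixedPoints (α.spectralSubspace n) :=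
  Module.Projective.of_split F.embed F.proj (LinearMap.ext F.proj_embed)

/-- As `proj ∘ embed` is the identity, `embed` has the same range as the idempotent `embed ∘ proj`,
which is `v ↦ v E`. -/
theorem represents : KTheory.K0.Represents F.idem (α.spectralSubspace n) := by
  have hrange : LinearMap.range F.embed = LinearMap.range (Matrix.vecMulLinear F.idem.mat) := by
    apply le_antisymm
    · rintro _ ⟨x, rfl⟩
      exact ⟨F.embed x, by rw [← embed_proj, proj_embed]⟩
    · rintro _ ⟨v, rfl⟩
      exact ⟨F.proj v, F.embed_proj v⟩
  exact ⟨(LinearEquiv.ofInjective F.embed (Function.LeftInverse.injective F.proj_embed)).trans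
    (LinearEquiv.ofEq _ _ hrange)⟩

/-! ### Transport of frames along `f` and the map on `K₀` -/

variable {A' : Type*} [CStarAlgebra A'] {α' : CircleAction A'} {f : A →⋆ₐ[ℂ] A'}

theorem _root_.CircleAction.IsEquivariant.map_mem (hf : IsEquivariant α α' f) {m : ℤ} {x : A}
    (hx : x ∈ α.spectralSubspace m) : f x ∈ α'.spectralSubspace m := fun z => by
  rw [← hf z, hx z, map_smul]

/-- The image of a frame under an equivariant homomorphism. -/
def map (hf : IsEquivariant α α' f) : α'.Frame n where
  size := F.size
  a i := f (F.a i)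
  b i := f (F.b i)
  a_mem i := hf.map_mem (F.a_mem i)
  b_mem i := hf.map_mem (F.b_mem i)
  sum_eq_one := by simp_rw [← map_mul, ← map_sum, F.sum_eq_one, map_one]

theorem idem_map (hf : IsEquivariant α α' f) :
    F.idem.map (restrictFixed hf : α.fixedPoints →+* α'.fixedPoints) = (F.map hf).idem := by
  have h : F.idem.mat.map (restrictFixed hf : α.fixedPoints →+* α'.fixedPoints) =
      (F.map hf).idem.mat := by
    ext i j
    exact map_mul f (F.b i) (F.a j)
  unfold KTheory.Idem.map
  congr 1

include F in
theorem k0Map_ofModule (hf : IsEquivariant α α' f)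
    (hfin : Module.Finite α.fixedPoints (α.spectralSubspace n))
    (hproj : Module.Projective α.fixedPoints (α.spectralSubspace n))
    (hfin' : Module.Finite α'.fixedPoints (α'.spectralSubspace n))
    (hproj' : Module.Projective α'.fixedPoints (α'.spectralSubspace n)) :
    KTheory.K0.map (restrictFixed hf : α.fixedPoints →+* α'.fixedPoints)
        (KTheory.K0.ofModule (α.spectralSubspace n) hfin hproj) =
      KTheory.K0.ofModule (α'.spectralSubspace n) hfin' hproj' := by
  rw [KTheory.K0.ofModule_eq_mk hfin hproj F.represents,
    KTheory.K0.ofModule_eq_mk hfin' hproj' (F.map hf).represents, ← F.idem_map hf]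
  -- On the class of an idempotent, the lifted homomorphism is the entrywise map.
  exact DFunLike.congr_fun (Algebra.GrothendieckAddGroup.lift.symm_apply_apply
    (Algebra.GrothendieckAddGroup.of.comp
      (KTheory.V.map (restrictFixed hf : α.fixedPoints →+* α'.fixedPoints)))) (KTheory.V.mk F.idem)

end Frame

/-! ### The isomorphism with the extension of scalars -/

section ExtendScalars

variable {A A' : Type*} [CStarAlgebra A] [CStarAlgebra A'] {α : CircleAction A}
  {α' : CircleAction A'} {f : A →⋆ₐ[ℂ] A'} (hf : IsEquivariant α α' f) (n : ℤ)

/-- `f` restricted to the spectral subspaces of degree `n`. -/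
noncomputable def restrictSpectral : α.spectralSubspace n →ₗ[ℤ] α'.spectralSubspace n :=
  AddMonoidHom.toIntLinearMap
    { toFun := fun x => ⟨f x.1, hf.map_mem x.2⟩
      map_zero' := Subtype.ext (map_zero f)
      map_add' := fun x y => Subtype.ext (map_add f x.1 y.1) }

/-- The canonical map `b' ⊗ x ↦ b' * f x`. -/
noncomputable def extendHom :
    ExtendScalars (restrictFixed hf : α.fixedPoints →+* α'.fixedPoints)
      (α.spectralSubspace n) →ₗ[α'.fixedPoints] α'.spectralSubspace n :=
  Submodule.liftQ _
    (TensorProduct.AlgebraTensorModule.lift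
      (LinearMap.toSpanSingleton α'.fixedPoints
        (α.spectralSubspace n →ₗ[ℤ] α'.spectralSubspace n) (restrictSpectral hf n)))
    (by
      rw [Submodule.span_le]
      rintro _ ⟨s, r, m, rfl⟩
      rw [SetLike.mem_coe, LinearMap.mem_ker, map_sub, sub_eq_zero]
      apply Subtype.ext
      change (s.1 * f r.1) * f m.1 = s.1 * f (r.1 * m.1)
      rw [map_mul, mul_assoc])

variable {n}

/-- The inverse `y ↦ ∑ y * f (a i) ⊗ b i` of the canonical map. -/
noncomputable def Frame.extendInv (F : α.Frame n) : α'.spectralSubspace n →ₗ[α'.fixedPoints]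
    ExtendScalars (restrictFixed hf : α.fixedPoints →+* α'.fixedPoints) (α.spectralSubspace n) :=
  ∑ i : Fin F.size, (LinearMap.toSpanSingleton α'.fixedPoints _
    (Submodule.Quotient.mk ((1 : α'.fixedPoints) ⊗ₜ[ℤ] F.gen i))) ∘ₗ (F.map hf).coord i

theorem Frame.extendInv_apply (F : α.Frame n) (y : α'.spectralSubspace n) :
    F.extendInv hf y = ∑ i : Fin F.size,
      Submodule.Quotient.mk ((F.map hf).coord i y ⊗ₜ[ℤ] F.gen i) := by
  simp only [extendInv, LinearMap.sum_apply, LinearMap.comp_apply,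
    LinearMap.toSpanSingleton_apply]
  refine Finset.sum_congr rfl fun i _ => ?_
  rw [← Submodule.Quotient.mk_smul, TensorProduct.smul_tmul', smul_eq_mul, mul_one]

/-- `B' ⊗_B A_n ≅ A'_n`. -/
noncomputable def Frame.extendEquiv (F : α.Frame n) :
    ExtendScalars (restrictFixed hf : α.fixedPoints →+* α'.fixedPoints) (α.spectralSubspace n)
      ≃ₗ[α'.fixedPoints] α'.spectralSubspace n :=
  LinearEquiv.ofLinearMap (extendHom hf n) (F.extendInv hf)
    (by
      ext1 y
      rw [LinearMap.comp_apply, F.extendInv_apply, map_sum]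
      exact (F.map hf).sum_coord_smul y)
    (by
      refine Submodule.linearMap_qext _ (TensorProduct.AlgebraTensorModule.ext fun s x => ?_)
      change F.extendInv hf (s • restrictSpectral hf n x) = Submodule.Quotient.mk (s ⊗ₜ[ℤ] x)
      rw [F.extendInv_apply]
      -- Expand `x = ∑ (x * a i) * b i`; each coefficient `x * a i` lies in `B` and moves across the
      -- tensor sign as `f (x * a i)`.
      conv_rhs => rw [← F.sum_coord_smul x, TensorProduct.tmul_sum, ← Submodule.mkQ_apply, map_sum]
      refine Finset.sum_congr rfl fun i _ => ?_
      have h : (F.map hf).coord i (s • restrictSpectral hf n x) =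
          s * (restrictFixed hf : α.fixedPoints →+* α'.fixedPoints) (F.coord i x) := by
        apply Subtype.ext
        change (s.1 * f x.1) * f (F.a i) = s.1 * f (x.1 * F.a i)
        rw [map_mul, mul_assoc]
      rw [h, Submodule.mkQ_apply, Submodule.Quotient.eq]
      exact Submodule.subset_span ⟨s, F.coord i x, F.gen i, rfl⟩)

end ExtendScalars

end CircleAction

theorem mainTheorem3 {A A' : Type*} [CStarAlgebra A] [CStarAlgebra A']
    (α : CircleAction A) (α' : CircleAction A')
    (f : A →⋆ₐ[ℂ] A') (hf : CircleAction.IsEquivariant α α' f) (hfree : α.IsCStarFree)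
    (n : ℤ) :
    Module.Finite α'.fixedPoints
        (ExtendScalars (CircleAction.restrictFixed hf : α.fixedPoints →+* α'.fixedPoints)
          (α.spectralSubspace n)) ∧
      Module.Finite α'.fixedPoints (α'.spectralSubspace n) ∧
      Nonempty
        (ExtendScalars (CircleAction.restrictFixed hf : α.fixedPoints →+* α'.fixedPoints)
          (α.spectralSubspace n) ≃ₗ[α'.fixedPoints] α'.spectralSubspace n) ∧
      ∃ (hfin : Module.Finite α.fixedPoints (α.spectralSubspace n))
        (hproj : Module.Projective α.fixedPoints (α.spectralSubspace n))
        (hfin' : Module.Finite α'.fixedPoints (α'.spectralSubspace n))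
        (hproj' : Module.Projective α'.fixedPoints (α'.spectralSubspace n)),
        KTheory.K0.map (CircleAction.restrictFixed hf : α.fixedPoints →+* α'.fixedPoints)
            (KTheory.K0.ofModule (α.spectralSubspace n) hfin hproj) =
          KTheory.K0.ofModule (α'.spectralSubspace n) hfin' hproj' := by
  obtain ⟨F⟩ := α.nonempty_frame hfree n
  have hfin' := (F.map hf).finite
  exact ⟨Module.Finite.equiv (F.extendEquiv hf).symm, hfin', ⟨F.extendEquiv hf⟩,
    F.finite, F.projective, hfin', (F.map hf).projective, F.k0Map_ofModule hf _ _ _ _⟩
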